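/- Let $k$ be an infinite field. Call $h=(h_0,h_1,\dots,h_e)$ a Gorenstein $h$-vector of socle degree $e$ if there are an integer $r\ge 0$ and a homogeneous ideal $I$ of the polynomial ring $R=k[x_1,\dots,x_r]$ (standard grading) such that $A=R/I$ is artinian and Gorenstein, i.e. its socle $\{a\in A : x_1a=\dots=x_ra=0\}$ is one-dimensional over $k$, with $\dim_k A_d=h_d$ for $0\le d\le e$, $h_e\ne 0$, and $A_d=0$ for all $d>e$. Let $h=(h_0,\dots,h_e)$ be a Gorenstein $h$-vector of socle degree $e$, and let $i$ be an integer with $0\le i\le \frac e2-1$. Then $$\binom{e-i+2}{2}-\binom{e-2i-1}{2}=\frac12(i+3)(2e-3i),$$ and if $$h_i<\binom{e-i+2}{2}-\binom{e-2i-1}{2},$$ then $h_{i+1}\ge h_i$. -/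

import Mathlib

attribute [local instance] MvPolynomial.gradedAlgebra

/-- The homogeneous component of degree `d` of `R ⧸ I`, where `R = k[x_1, …, x_r]` carries the
standard grading: the image of the forms of degree `d`. -/
noncomputable def gradedPiece {k : Type*} [Field k] {r : ℕ} (I : Ideal (MvPolynomial (Fin r) k)) (d : ℕ) :
    Submodule k (MvPolynomial (Fin r) k ⧸ I) :=
  (MvPolynomial.homogeneousSubmodule (Fin r) k d).map (Ideal.Quotient.mkₐ k I).toLinearMap

/-- The Hilbert function `d ↦ dim_k (R ⧸ I)_d` of `R ⧸ I`. -/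
noncomputable def hilbertFunction {k : Type*} [Field k] {r : ℕ}
    (I : Ideal (MvPolynomial (Fin r) k)) (d : ℕ) : ℕ :=
  Module.finrank k (gradedPiece I d)

/-- The socle `(0 : 𝔪)` of `A = R ⧸ I`, with `𝔪` the ideal generated by the classes of the
variables: the elements of `A` that are killed by every variable. -/
noncomputable def algebraSocle {k : Type*} [Field k] {r : ℕ} (I : Ideal (MvPolynomial (Fin r) k)) :
    Submodule k (MvPolynomial (Fin r) k ⧸ I) where
  carrier := {a | ∀ j : Fin r, Ideal.Quotient.mk I (MvPolynomial.X j) * a = 0}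
  zero_mem' := fun j => mul_zero _
  add_mem' := fun {a b} ha hb j => by
    have h1 := ha j
    have h2 := hb j
    rw [mul_add, h1, h2, add_zero]
  smul_mem' := fun c a ha j => by
    have h1 := ha j
    rw [mul_smul_comm, h1, smul_zero]

/-- `R ⧸ I` is a standard graded artinian Gorenstein `k`-algebra: `I` is homogeneous, `R ⧸ I` is
artinian, and its socle is one-dimensional over `k`. -/
structure IsArtinianGorenstein {k : Type*} [Field k] {r : ℕ}
    (I : Ideal (MvPolynomial (Fin r) k)) : Prop where
  homogeneous : I.IsHomogeneous (MvPolynomial.homogeneousSubmodule (Fin r) k)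
  artinian : IsArtinianRing (MvPolynomial (Fin r) k ⧸ I)
  finrank_socle : Module.finrank k (algebraSocle I) = 1

/-- `h = (h 0, h 1, …, h e)` (extended by zero) is a Gorenstein `h`-vector of socle degree `e` over
`k`: it is the Hilbert function of a standard graded artinian Gorenstein `k`-algebra
`k[x_1, …, x_r] ⧸ I`, and `e` is the last degree in which it does not vanish. -/
def IsGorensteinHVector (k : Type*) [Field k] (e : ℕ) (h : ℕ → ℕ) : Prop :=
  ∃ (r : ℕ) (I : Ideal (MvPolynomial (Fin r) k)),
    IsArtinianGorenstein I ∧ (∀ d, h d = hilbertFunction I d) ∧ h e ≠ 0 ∧ ∀ d, e < d → h d = 0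

/-! For a linear form `L ∈ A_1`, Gorenstein duality gives multiplication by `L` the same rank on
`A_i → A_{i+1}` as on `A_{e-i-1} → A_{e-i}`. As `h_{e-i} = h_i`, a drop `h_{i+1} < h_i` makes the
Hilbert function of `A / L A` strictly larger in degree `e - i` than in degree `i + 1`. By
Macaulay's growth bound its value in degree `i + 1` is then at least `i + 2`, so its value in degree
`e - i` is at least `i + 3`. As this holds for every `L`, Green's restriction theorem gives
`h_i = h_{e-i} ≥ ∑_{t ≤ e-i} min (i + 3) (t + 1)`, which is the binomial bound. -/

open scoped Pointwise
open Module Filter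

section LinearAlgebra

variable {k U V W : Type*} [Field k] [AddCommGroup U] [Module k U] [AddCommGroup V] [Module k V]
  [AddCommGroup W] [Module k W]

theorem finrank_map_add_finrank_inf_ker (f : U →ₗ[k] W) (N : Submodule k U) [Module.Finite k N] :
    finrank k (N.map f) + finrank k (N ⊓ LinearMap.ker f : Submodule k U) = finrank k N := by
  have h := LinearMap.finrank_range_add_finrank_ker (f.domRestrict N)
  have hker : LinearMap.ker (f.domRestrict N) = (LinearMap.ker f).comap N.subtype := rfl
  rwa [LinearMap.range_domRestrict, hker,
    ← Submodule.finrank_map_subtype_eq, Submodule.map_comap_subtype] at h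

theorem finrank_sup_eq_add_finrank_map_mkQ (Q N : Submodule k U) [Module.Finite k Q]
    [Module.Finite k N] :
    finrank k (Q ⊔ N : Submodule k U) = finrank k Q + finrank k (N.map Q.mkQ) := by
  have hmap := finrank_map_add_finrank_inf_ker Q.mkQ N
  have hsup := Submodule.finrank_sup_add_finrank_inf_eq Q N
  rw [Submodule.ker_mkQ, inf_comm] at hmap
  omega

theorem exists_dual_disjoint_ker_of_finrank_eq_one {N : Submodule k U} (hN : finrank k N = 1) :
    ∃ φ : Dual k U, Disjoint N (LinearMap.ker φ) := by
  have : Module.Finite k N := Module.finite_of_finrank_eq_succ hN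
  let e : N ≃ₗ[k] k := LinearEquiv.ofFinrankEq N k (by rw [hN, finrank_self])
  obtain ⟨φ, hφ⟩ := LinearMap.exists_extend e.toLinearMap
  refine ⟨φ, Submodule.disjoint_def.2 fun z hz hφz => ?_⟩
  have hez : e ⟨z, hz⟩ = 0 := (LinearMap.congr_fun hφ ⟨z, hz⟩).symm.trans hφz
  exact congrArg Subtype.val (e.map_eq_zero_iff.1 hez)

theorem finrank_range_flip [Module.Finite k U] [Module.Finite k V] (B : U →ₗ[k] V →ₗ[k] k) :
    finrank k (LinearMap.range B.flip) = finrank k (LinearMap.range B) := by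
  have h : B.flip = B.dualMap ∘ₗ (evalEquiv k V).toLinearMap := rfl
  rw [h, LinearMap.range_comp_of_range_eq_top _ (LinearEquiv.range _),
    LinearMap.finrank_range_dualMap_eq_finrank_range]

theorem finrank_range_eq_of_ker_eq [Module.Finite k U] {W' : Type*} [AddCommGroup W'] [Module k W']
    {f : U →ₗ[k] W} {g : U →ₗ[k] W'} (h : LinearMap.ker f = LinearMap.ker g) :
    finrank k (LinearMap.range f) = finrank k (LinearMap.range g) := by
  have hf := f.finrank_range_add_finrank_ker
  have hg := g.finrank_range_add_finrank_ker
  rw [h] at hf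
  omega

end LinearAlgebra

section ZariskiGeneric

variable (k : Type*) {U V W : Type*} [Field k] [AddCommGroup U] [Module k U] [AddCommGroup V]
  [Module k V] [AddCommGroup W] [Module k W]

variable (V) in
/-- The filter generated by the nonempty Zariski-open subsets of the finite-dimensional space `V`:
a property holds for `zariskiGeneric k V`-almost every vector if it holds wherever some nonzero
polynomial in the coordinates does not vanish. Over an infinite field every such property is
satisfied by some vector. -/
def zariskiGeneric [Module.Finite k V] : Filter V where
  sets := {s | ∃ p : MvPolynomial (Fin (finrank k V)) k, p ≠ 0 ∧
    ∀ v, MvPolynomial.eval ((finBasis k V).repr v) p ≠ 0 → v ∈ s}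
  univ_sets := ⟨1, one_ne_zero, fun _ _ => trivial⟩
  sets_of_superset := fun ⟨p, hp, h⟩ hst => ⟨p, hp, fun v hv => hst (h v hv)⟩
  inter_sets := fun ⟨p, hp, hs⟩ ⟨q, hq, ht⟩ => ⟨p * q, mul_ne_zero hp hq, fun v hv => by
    rw [map_mul] at hv
    exact ⟨hs v (left_ne_zero_of_mul hv), ht v (right_ne_zero_of_mul hv)⟩⟩

instance zariskiGeneric_neBot [Infinite k] [Module.Finite k V] : (zariskiGeneric k V).NeBot := by
  refine ⟨fun hbot => ?_⟩
  obtain ⟨p, hp, h⟩ : ∅ ∈ zariskiGeneric k V := hbot ▸ mem_bot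
  refine hp (MvPolynomial.funext fun a => ?_)
  by_contra ha
  refine h ((finBasis k V).equivFun.symm a) ?_
  rwa [← Basis.equivFun_apply, LinearEquiv.apply_symm_apply]

variable {k} [Module.Finite k V]

theorem eventually_isUnit_of_isUnit [Module.Finite k W] (φ : V →ₗ[k] End k W) {v₀ : V}
    (h : IsUnit (φ v₀)) : ∀ᶠ v in zariskiGeneric k V, IsUnit (φ v) := by
  classical
  let w := finBasis k W
  let M : Matrix (Fin (finrank k W)) (Fin (finrank k W)) (MvPolynomial (Fin (finrank k V)) k) :=
    Matrix.of fun i j => ((w.coord i ∘ₗ LinearMap.applyₗ (w j)) ∘ₗ φ).toMvPolynomial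
      (finBasis k V) (Basis.singleton Unit k) ()
  have hM (v : V) : MvPolynomial.eval ((finBasis k V).repr v) M.det = LinearMap.det (φ v) := by
    rw [RingHom.map_det, ← LinearMap.det_toMatrix w]
    congr 1
    ext i j
    simp [M, LinearMap.toMvPolynomial_eval_eq_apply, LinearMap.toMatrix_apply]
  have hunit (v : V) : IsUnit (φ v) ↔ MvPolynomial.eval ((finBasis k V).repr v) M.det ≠ 0 := by
    rw [LinearMap.isUnit_iff_isUnit_det, isUnit_iff_ne_zero, hM]
  refine ⟨M.det, fun hdet => (hunit v₀).1 h ?_, fun v => (hunit v).2⟩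
  rw [hdet, map_zero]

/-- Compressing `f v` to an endomorphism of the range of `f v₀` that is the identity at `v₀`
reduces semicontinuity of the rank to the openness of invertibility. -/
theorem eventually_finrank_range_le [Module.Finite k U] (f : V →ₗ[k] U →ₗ[k] W) (v₀ : V) :
    ∀ᶠ v in zariskiGeneric k V,
      finrank k (LinearMap.range (f v₀)) ≤ finrank k (LinearMap.range (f v)) := by
  set S := LinearMap.range (f v₀)
  obtain ⟨s, hs⟩ := (f v₀).rangeRestrict.exists_rightInverse_of_surjective
    (f v₀).range_rangeRestrict
  obtain ⟨g, hg⟩ := S.subtype.exists_leftInverse_of_injective S.ker_subtype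
  let φ : V →ₗ[k] End k S := (f.compr₂ g).compl₂ s
  have hφ : φ v₀ = 1 := calc
    φ v₀ = (g ∘ₗ S.subtype) ∘ₗ (f v₀).rangeRestrict ∘ₗ s := rfl
    _ = 1 := by rw [hg, hs]; rfl
  filter_upwards [eventually_isUnit_of_isUnit φ (hφ ▸ isUnit_one)] with v hv
  have htop : ⊤ ≤ (LinearMap.range (f v)).map g := fun y _ => by
    obtain ⟨z, rfl⟩ := ((End.isUnit_iff _).1 hv).2 y
    exact ⟨_, ⟨s z, rfl⟩, rfl⟩
  calc finrank k S = finrank k (⊤ : Submodule k S) := finrank_top k S |>.symm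
    _ ≤ finrank k ((LinearMap.range (f v)).map g) := Submodule.finrank_mono htop
    _ ≤ finrank k (LinearMap.range (f v)) := Submodule.finrank_map_le _ _

end ZariskiGeneric

section GeneratedSubspaces

variable {k A M : Type*} [Field k] [CommRing A] [Algebra k A] [AddCommGroup M] [Module k M]
  [Module A M] [IsScalarTower k A M]

instance finite_pointwise_smul (a : A) (N : Submodule k M) [Module.Finite k N] :
    Module.Finite k (a • N : Submodule k M) :=
  inferInstanceAs (Module.Finite k (N.map _))

instance finite_submodule_smul (V : Submodule k A) (N : Submodule k M) [Module.Finite k V]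
    [Module.Finite k N] : Module.Finite k (V • N : Submodule k M) := by
  have hle : V • N ≤ Submodule.map₂ (Algebra.lsmul k k M).toLinearMap V N :=
    Submodule.smul_le.2 fun a ha y hy =>
      Submodule.apply_mem_map₂ (Algebra.lsmul k k M).toLinearMap ha hy
  have : Module.Finite k (Submodule.map₂ (Algebra.lsmul k k M).toLinearMap V N) :=
    Module.Finite.iff_fg.2 (.map₂ _ (Module.Finite.iff_fg.1 ‹_›) (Module.Finite.iff_fg.1 ‹_›))
  exact Submodule.finiteDimensional_of_le hle

instance finite_submodule_pow (V : Submodule k A) [Module.Finite k V] (n : ℕ) :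
    Module.Finite k (V ^ n : Submodule k A) :=
  Module.Finite.iff_fg.2 ((Module.Finite.iff_fg.1 ‹_›).pow n)

instance finite_submodule_one : Module.Finite k (1 : Submodule k A) :=
  Module.Finite.iff_fg.2 (Submodule.one_eq_span (R := k) (A := A) ▸ Submodule.fg_span_singleton 1)

instance smulCommClass_submodule : SMulCommClass A (Submodule k A) (Submodule k M) where
  smul_comm a V N := by
    refine le_antisymm ?_ (Submodule.smul_le.2 ?_)
    · rw [Submodule.pointwise_smul_def, Submodule.map_le_iff_le_comap, Submodule.smul_le]
      intro b hb y hy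
      change a • b • y ∈ V • a • N
      rw [smul_comm a b y]
      exact Submodule.smul_mem_smul hb (Submodule.smul_mem_pointwise_smul _ _ _ hy)
    · rintro b hb _ ⟨y, hy, rfl⟩
      change b • a • y ∈ a • V • N
      rw [smul_comm b a y]
      exact Submodule.smul_mem_pointwise_smul _ _ _ (Submodule.smul_mem_smul hb hy)

theorem submodule_pow_succ_smul (V : Submodule k A) (U : Submodule k M) (n : ℕ) :
    V ^ (n + 1) • U = V • V ^ n • U := by
  rw [pow_succ', ← smul_eq_mul, Submodule.smul_assoc]

variable {V : Submodule k A} (Q N : Submodule k M)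

theorem coe_smul_le_smul (b : V) : (b : A) • N ≤ V • N := by
  rintro _ ⟨y, hy, rfl⟩
  exact Submodule.smul_mem_smul b.2 hy

theorem exists_forall_finrank_smul_le (V : Submodule k A) [Module.Finite k N] :
    ∃ b₀ : V, ∀ b : V, finrank k ((b : A) • N : Submodule k M) ≤
      finrank k ((b₀ : A) • N : Submodule k M) := by
  let S : Set ℕ := Set.range fun b : V => finrank k ((b : A) • N : Submodule k M)
  have hbdd : BddAbove S := ⟨finrank k N, by
    rintro _ ⟨b, rfl⟩
    exact Submodule.finrank_map_le _ _⟩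
  obtain ⟨_, ⟨b₀, rfl⟩, hb₀⟩ := hbdd.exists_isGreatest_of_nonempty (Set.range_nonempty _)
  exact ⟨b₀, fun b => hb₀ ⟨b, rfl⟩⟩

theorem finrank_smul_sup_smul_add_le {N P : Submodule k M} [Module.Finite k P] {a b : A}
    (ha : a • N ≤ P) (hb : b • N ≤ P) :
    finrank k (a • P ⊔ b • P : Submodule k M) + finrank k (a • b • N : Submodule k M) ≤
      finrank k (a • P : Submodule k M) + finrank k (b • P : Submodule k M) := by
  have hinf : a • b • N ≤ a • P ⊓ b • P := by
    refine le_inf (Submodule.map_mono hb) ?_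
    rw [smul_comm]
    exact Submodule.map_mono ha
  have := Submodule.finrank_mono hinf
  have := Submodule.finrank_sup_add_finrank_inf_eq (a • P) (b • P)
  omega

variable [Module.Finite k V]

variable {N} in
theorem eventually_smul_le {ι : Type*} {F : Filter ι} {P : ι → Submodule k M}
    (h : ∀ b : V, ∀ᶠ i in F, (b : A) • N ≤ P i) : ∀ᶠ i in F, V • N ≤ P i := by
  obtain ⟨s, hs⟩ : V.FG := Module.Finite.iff_fg.1 ‹_›
  have hgen : ∀ᶠ i in F, ∀ b ∈ s, (b : A) • N ≤ P i :=
    (eventually_all_finset s).2 fun b hb => h ⟨b, hs ▸ Submodule.subset_span hb⟩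
  filter_upwards [hgen] with i hi
  rw [Submodule.smul_le, ← hs]
  intro b hb y hy
  induction hb using Submodule.span_induction with
  | mem b hb => exact hi b hb (Submodule.smul_mem_pointwise_smul _ _ _ hy)
  | zero => rw [zero_smul]; exact Submodule.zero_mem _
  | add b c _ _ hb hc => rw [add_smul]; exact Submodule.add_mem _ hb hc
  | smul c b _ hb => rw [smul_assoc]; exact Submodule.smul_mem _ _ hb

theorem eventually_finrank_sup_smul_le [Module.Finite k Q] [Module.Finite k N] (a₀ : V) :
    ∀ᶠ a : V in zariskiGeneric k V, finrank k (Q ⊔ (a₀ : A) • N : Submodule k M) ≤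
      finrank k (Q ⊔ (a : A) • N : Submodule k M) := by
  let f : V →ₗ[k] N →ₗ[k] M ⧸ Q :=
    ((Algebra.lsmul k k M).toLinearMap.domRestrict₁₂ V N).compr₂ Q.mkQ
  have hf (a : V) : LinearMap.range (f a) = ((a : A) • N).map Q.mkQ := by
    have : f a = Q.mkQ ∘ₗ (Algebra.lsmul k k M (a : A)).domRestrict N := rfl
    rw [this, LinearMap.range_comp, LinearMap.range_domRestrict]
    rfl
  filter_upwards [eventually_finrank_range_le f a₀] with a ha
  rw [hf, hf] at ha
  rw [finrank_sup_eq_add_finrank_map_mkQ, finrank_sup_eq_add_finrank_map_mkQ]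
  exact Nat.add_le_add_left ha _

variable {Q N}

theorem eventually_le_sup_smul {P : Submodule k M} [Module.Finite k Q] [Module.Finite k N]
    [Module.Finite k P] (hNP : V • N ≤ P) {a₀ : V} (h : P ≤ Q ⊔ (a₀ : A) • N) :
    ∀ᶠ a : V in zariskiGeneric k V, P ≤ Q ⊔ (a : A) • N := by
  filter_upwards [eventually_finrank_sup_smul_le Q N a₀] with a ha
  have hle : Q ⊔ (a : A) • N ≤ Q ⊔ P := sup_le_sup_left ((coe_smul_le_smul N a).trans hNP) _
  have hge : Q ⊔ P ≤ Q ⊔ (a₀ : A) • N := sup_le le_sup_left h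
  exact le_sup_right.trans_eq
    (Submodule.eq_of_le_of_finrank_le hle ((Submodule.finrank_mono hge).trans ha)).symm

theorem exists_forall_not_smul_le_sup_smul_smul [Infinite k] [Module.Finite k Q]
    [Module.Finite k N] (h : ∀ a : V, ¬ V • V • N ≤ Q ⊔ (a : A) • V • N) :
    ∃ b : V, ∀ a : V, ¬ (b : A) • V • N ≤ Q ⊔ (a : A) • (b : A) • N := by
  by_contra! hcon
  have hgen : ∀ᶠ a : V in zariskiGeneric k V, V • V • N ≤ Q ⊔ (a : A) • V • N := by
    refine eventually_smul_le fun b => ?_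
    obtain ⟨a₀, ha₀⟩ := hcon b
    filter_upwards [eventually_le_sup_smul (smul_comm (b : A) V N).ge ha₀] with a ha
    exact ha.trans (sup_le_sup_left (Submodule.map_mono (coe_smul_le_smul N b)) _)
  obtain ⟨a, ha⟩ := hgen.exists
  exact h a ha

theorem exists_add_finrank_le_finrank_sup_smul [Infinite k] [Module.Finite k Q] {U : Submodule k M}
    [Module.Finite k U] (n : ℕ) (h : ∀ a : V, ¬ V ^ (n + 1) • U ≤ Q ⊔ (a : A) • V ^ n • U) :
    ∃ a : V, n + 1 + finrank k Q ≤ finrank k (Q ⊔ (a : A) • V ^ n • U : Submodule k M) := by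
  induction n generalizing U with
  | zero =>
    obtain ⟨a, ha⟩ : ∃ a : V, ¬ (a : A) • U ≤ Q := by
      by_contra! hQ
      refine h 0 (le_sup_of_le_left ?_)
      rw [zero_add, pow_one, Submodule.smul_le]
      exact fun b hb y hy => hQ ⟨b, hb⟩ (Submodule.smul_mem_pointwise_smul _ _ _ hy)
    refine ⟨a, ?_⟩
    rw [pow_zero, Submodule.one_smul]
    have := Submodule.finrank_lt_finrank_of_lt (left_lt_sup.2 ha)
    omega
  | succ n ih =>
    rw [submodule_pow_succ_smul, submodule_pow_succ_smul] at h
    obtain ⟨b, hb⟩ := exists_forall_not_smul_le_sup_smul_smul h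
    obtain ⟨a, ha⟩ := ih (U := (b : A) • U) (by
      simpa only [← smul_comm (b : A), ← submodule_pow_succ_smul] using hb)
    have hlt : Q ⊔ (a : A) • (b : A) • V ^ n • U < Q ⊔ (b : A) • V • V ^ n • U := by
      refine lt_of_le_not_ge (sup_le_sup_left ?_ _) fun hge => hb a (le_sup_right.trans hge)
      rw [smul_comm (a : A)]
      exact Submodule.map_mono (coe_smul_le_smul _ a)
    have := Submodule.finrank_lt_finrank_of_lt hlt
    rw [← smul_comm (b : A)] at ha
    rw [submodule_pow_succ_smul]
    exact ⟨b, by omega⟩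

theorem exists_min_add_finrank_le_finrank_sup_smul [Infinite k] [Module.Finite k Q]
    {U : Submodule k M} [Module.Finite k U] {c n : ℕ}
    (h : c + finrank k Q ≤ finrank k (V ^ (n + 1) • U : Submodule k M)) :
    ∃ a : V, min c (n + 1) + finrank k Q ≤
      finrank k (Q ⊔ (a : A) • V ^ n • U : Submodule k M) := by
  by_cases hgen : ∃ a : V, V ^ (n + 1) • U ≤ Q ⊔ (a : A) • V ^ n • U
  · obtain ⟨a, ha⟩ := hgen
    have := Submodule.finrank_mono ha
    exact ⟨a, by omega⟩
  · push Not at hgen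
    obtain ⟨a, ha⟩ := exists_add_finrank_le_finrank_sup_smul n hgen
    exact ⟨a, by omega⟩

theorem exists_forall_min_add_finrank_smul_smul_le [Infinite k] [Module.Finite k N]
    {U : Submodule k M} [Module.Finite k U] {c n : ℕ} (hN : V • N ≤ V ^ n • U)
    (h : ∀ a : V, c + finrank k ((a : A) • V ^ n • U : Submodule k M) ≤
      finrank k (V ^ (n + 1) • U : Submodule k M)) :
    ∃ b : V, ∀ a : V, min c (n + 1) + finrank k ((a : A) • (b : A) • N : Submodule k M) ≤
      finrank k ((b : A) • V ^ n • U : Submodule k M) := by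
  have hle (a : V) : (a : A) • N ≤ V ^ n • U := (coe_smul_le_smul N a).trans hN
  obtain ⟨b₀, hb₀⟩ := exists_forall_finrank_smul_le (V ^ n • U) V
  refine ⟨b₀, fun a₀ => ?_⟩
  obtain ⟨a, ha⟩ := exists_min_add_finrank_le_finrank_sup_smul (h a₀)
  -- A general `b` makes `a₀ • P ⊔ b • P` and `b • a₀ • N` large, where `P = V ^ n • U`; their
  -- dimensions bound that of `b • P` from below.
  obtain ⟨b, hsup, hinf⟩ :=
    ((eventually_finrank_sup_smul_le ((a₀ : A) • V ^ n • U) (V ^ n • U) a).and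
      (eventually_finrank_sup_smul_le ⊥ ((a₀ : A) • N) b₀)).exists
  rw [bot_sup_eq, bot_sup_eq, smul_comm _ (a₀ : A), smul_comm _ (a₀ : A)] at hinf
  have hmod := finrank_smul_sup_smul_add_le (hle a₀) (hle b)
  have := hb₀ b
  omega

/-- Green's hyperplane restriction theorem, sharp for `c ≤ n + 2`. The induction passes from
`U` to a multiple `b • U` by a linear form. -/
theorem sum_min_le_finrank_pow_smul [Infinite k] (U : Submodule k M) [Module.Finite k U]
    (c n : ℕ) (h : ∀ a : V, c + finrank k ((a : A) • V ^ n • U : Submodule k M) ≤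
      finrank k (V ^ (n + 1) • U : Submodule k M)) :
    ∑ t ∈ Finset.range (n + 2), min c (t + 1) ≤ finrank k (V ^ (n + 1) • U : Submodule k M) := by
  induction n generalizing U c with
  | zero =>
    obtain ⟨a, ha⟩ := exists_min_add_finrank_le_finrank_sup_smul (V := V) (U := U) (c := c)
      (n := 0) (Q := ⊥) (by have := h 0; rw [finrank_bot]; omega)
    have := h a
    rw [bot_sup_eq, finrank_bot] at ha
    simp only [Finset.sum_range_succ, Finset.range_zero, Finset.sum_empty]
    omega
  | succ n ih =>
    obtain ⟨b, hb⟩ := exists_forall_min_add_finrank_smul_smul_le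
      (submodule_pow_succ_smul V U n).ge h
    have hind := ih ((b : A) • U) (min c (n + 2)) fun a => by
      rw [← smul_comm (b : A) (V ^ n), ← smul_comm (b : A) (V ^ (n + 1))]
      exact hb a
    have hsum : ∑ t ∈ Finset.range (n + 2), min (min c (n + 2)) (t + 1) =
        ∑ t ∈ Finset.range (n + 2), min c (t + 1) :=
      Finset.sum_congr rfl fun t ht => by
        have := Finset.mem_range.1 ht
        omega
    rw [← smul_comm (b : A), hsum] at hind
    rw [Finset.sum_range_succ]
    have := h b
    omega

theorem sum_min_le_finrank_pow [Infinite k] {c n : ℕ}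
    (h : ∀ a : V, c + finrank k ((a : A) • V ^ n : Submodule k A) ≤
      finrank k (V ^ (n + 1) : Submodule k A)) :
    ∑ t ∈ Finset.range (n + 2), min c (t + 1) ≤ finrank k (V ^ (n + 1) : Submodule k A) := by
  have hone (d : ℕ) : V ^ d • (1 : Submodule k A) = V ^ d := mul_one _
  have hgreen := sum_min_le_finrank_pow_smul (V := V) (1 : Submodule k A) c n fun a => by
    rw [hone, hone]
    exact h a
  rwa [hone] at hgreen

/-- Macaulay's growth bound, in the range where it forbids any growth. -/
theorem finrank_pow_succ_smul_le [Infinite k] {U : Submodule k M} [Module.Finite k U] {n : ℕ}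
    (h : finrank k (V ^ n • U : Submodule k M) ≤ n) :
    finrank k (V ^ (n + 1) • U : Submodule k M) ≤ finrank k (V ^ n • U : Submodule k M) := by
  obtain _ | n := n
  · have hU : U = ⊥ := Submodule.finrank_eq_zero.1 (by simpa [Submodule.one_smul] using h)
    rw [hU, Submodule.smul_bot]
    simp
  obtain ⟨a, ha⟩ : ∃ a : V, V ^ (n + 1) • U ≤ (a : A) • V ^ n • U := by
    by_contra! hcon
    obtain ⟨a, ha⟩ := exists_add_finrank_le_finrank_sup_smul (Q := ⊥) n (by simpa using hcon)
    rw [bot_sup_eq, finrank_bot, add_zero] at ha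
    have hle : (a : A) • V ^ n • U ≤ V ^ (n + 1) • U :=
      (coe_smul_le_smul _ a).trans_eq (submodule_pow_succ_smul V U n).symm
    exact hcon a (Submodule.eq_of_le_of_finrank_le hle (h.trans ha)).ge
  have hle : V ^ (n + 2) • U ≤ (a : A) • V ^ (n + 1) • U := calc
    V ^ (n + 2) • U = V • V ^ (n + 1) • U := submodule_pow_succ_smul V U (n + 1)
    _ ≤ V • (a : A) • V ^ n • U := Submodule.smul_mono le_rfl ha
    _ = (a : A) • V ^ (n + 1) • U := by rw [← smul_comm, submodule_pow_succ_smul]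
  exact (Submodule.finrank_mono hle).trans (Submodule.finrank_map_le _ _)

theorem finrank_pow_smul_le_of_le [Infinite k] {U : Submodule k M} [Module.Finite k U] {m n : ℕ}
    (hmn : m ≤ n) (h : finrank k (V ^ m • U : Submodule k M) ≤ m) :
    finrank k (V ^ n • U : Submodule k M) ≤ finrank k (V ^ m • U : Submodule k M) := by
  induction n, hmn using Nat.le_induction with
  | base => exact le_rfl
  | succ n hmn ih => exact (finrank_pow_succ_smul_le (ih.trans (h.trans hmn))).trans ih

theorem finrank_pow_add_finrank_inf_le [Infinite k] (J : Ideal A) {m n : ℕ} (hmn : m ≤ n)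
    (h : finrank k (V ^ m : Submodule k A) ≤
      m + finrank k (V ^ m ⊓ J.restrictScalars k : Submodule k A)) :
    finrank k (V ^ n : Submodule k A) +
        finrank k (V ^ m ⊓ J.restrictScalars k : Submodule k A) ≤
      finrank k (V ^ m : Submodule k A) +
        finrank k (V ^ n ⊓ J.restrictScalars k : Submodule k A) := by
  let π := Ideal.Quotient.mkₐ k J
  have hker : LinearMap.ker π.toLinearMap = J.restrictScalars k := by
    ext a
    exact Ideal.Quotient.eq_zero_iff_mem
  have hrank (d : ℕ) : finrank k (V.map π.toLinearMap ^ d : Submodule k (A ⧸ J)) +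
      finrank k (V ^ d ⊓ J.restrictScalars k : Submodule k A) =
        finrank k (V ^ d : Submodule k A) := by
    rw [← hker, ← Submodule.map_pow]
    exact finrank_map_add_finrank_inf_ker _ _
  have hquot := finrank_pow_smul_le_of_le (V := V.map π.toLinearMap)
    (U := (1 : Submodule k (A ⧸ J))) hmn
  rw [smul_eq_mul, smul_eq_mul, mul_one, mul_one] at hquot
  have := hrank m
  have := hrank n
  omega

end GeneratedSubspaces

section GradedPiece

variable {k : Type*} [Field k] {r : ℕ} {I : Ideal (MvPolynomial (Fin r) k)}

theorem gradedPiece_eq_pow (I : Ideal (MvPolynomial (Fin r) k)) (n : ℕ) :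
    gradedPiece I n = gradedPiece I 1 ^ n := by
  rw [gradedPiece, gradedPiece, ← Submodule.map_pow, MvPolynomial.homogeneousSubmodule_one_pow]

theorem mul_mem_gradedPiece {m n : ℕ} {a b : MvPolynomial (Fin r) k ⧸ I}
    (ha : a ∈ gradedPiece I m) (hb : b ∈ gradedPiece I n) : a * b ∈ gradedPiece I (m + n) := by
  obtain ⟨f, hf, rfl⟩ := ha
  obtain ⟨g, hg, rfl⟩ := hb
  exact ⟨f * g, hf.mul hg, map_mul (Ideal.Quotient.mk I) f g⟩

theorem one_mem_gradedPiece : (1 : MvPolynomial (Fin r) k ⧸ I) ∈ gradedPiece I 0 :=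
  ⟨1, MvPolynomial.isHomogeneous_one _ _, map_one (Ideal.Quotient.mk I)⟩

theorem mk_X_mem_gradedPiece (i : Fin r) :
    Ideal.Quotient.mk I (MvPolynomial.X i) ∈ gradedPiece I 1 :=
  ⟨_, MvPolynomial.isHomogeneous_X k i, rfl⟩

instance finite_gradedPiece (n : ℕ) : Module.Finite k (gradedPiece I n) :=
  Module.Finite.iff_fg.2 ((MvPolynomial.homogeneousSubmodule_fg _ _ n).map _)

theorem sum_min_le_hilbertFunction [Infinite k] {c n : ℕ}
    (h : ∀ L ∈ gradedPiece I 1, c +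
      finrank k (L • gradedPiece I n : Submodule k (MvPolynomial (Fin r) k ⧸ I)) ≤
        hilbertFunction I (n + 1)) :
    ∑ t ∈ Finset.range (n + 2), min c (t + 1) ≤ hilbertFunction I (n + 1) := by
  rw [hilbertFunction, gradedPiece_eq_pow]
  refine sum_min_le_finrank_pow fun L => ?_
  rw [← gradedPiece_eq_pow, ← gradedPiece_eq_pow]
  exact h L L.2

theorem eq_zero_of_mem_gradedPiece_of_ne
    (hI : I.IsHomogeneous (MvPolynomial.homogeneousSubmodule (Fin r) k))
    {m n : ℕ} (hmn : m ≠ n) {a : MvPolynomial (Fin r) k ⧸ I}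
    (hm : a ∈ gradedPiece I m) (hn : a ∈ gradedPiece I n) : a = 0 := by
  obtain ⟨f, hf, rfl⟩ := hm
  obtain ⟨g, hg, hgf⟩ := hn
  have hfg : f - g ∈ I := Ideal.Quotient.eq.1 hgf.symm
  have h := hI m hfg
  rw [DirectSum.decompose_sub, DirectSum.sub_apply, AddSubgroupClass.coe_sub,
    DirectSum.decompose_of_mem_same _ hf, DirectSum.decompose_of_mem_ne _ hg hmn.symm,
    sub_zero] at h
  exact Ideal.Quotient.eq_zero_iff_mem.2 h

theorem gradedPiece_inf_span_singleton
    (hI : I.IsHomogeneous (MvPolynomial.homogeneousSubmodule (Fin r) k))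
    {d : ℕ} {L : MvPolynomial (Fin r) k ⧸ I}
    (hL : L ∈ gradedPiece I d) (n : ℕ) :
    gradedPiece I (d + n) ⊓ (Ideal.span {L}).restrictScalars k = L • gradedPiece I n := by
  refine le_antisymm ?_ ?_
  · obtain ⟨ℓ, hℓ, rfl⟩ := hL
    rintro _ ⟨⟨f, hf, rfl⟩, hfL⟩
    obtain ⟨b, hb⟩ := Ideal.mem_span_singleton.1 hfL
    obtain ⟨g, rfl⟩ := Ideal.Quotient.mk_surjective b
    have hfg : f - ℓ * g ∈ I :=
      Ideal.Quotient.eq.1 (hb.trans (map_mul (Ideal.Quotient.mk I) ℓ g).symm)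
    have h := hI (d + n) hfg
    rw [DirectSum.decompose_sub, DirectSum.sub_apply, AddSubgroupClass.coe_sub,
      DirectSum.decompose_of_mem_same _ hf,
      DirectSum.coe_decompose_mul_add_of_left_mem _ hℓ] at h
    exact ⟨_, ⟨_, (DirectSum.decompose _ g n).2, rfl⟩,
      (map_mul (Ideal.Quotient.mk I) _ _).symm.trans (Ideal.Quotient.eq.2 h).symm⟩
  · rintro _ ⟨b, hb, rfl⟩
    exact ⟨mul_mem_gradedPiece hL hb, Ideal.mem_span_singleton.2 (dvd_mul_right L b)⟩

theorem hilbertFunction_add_finrank_smul_le [Infinite k]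
    (hI : I.IsHomogeneous (MvPolynomial.homogeneousSubmodule (Fin r) k))
    {L : MvPolynomial (Fin r) k ⧸ I}
    (hL : L ∈ gradedPiece I 1) {m n : ℕ} (hmn : m ≤ n)
    (h : hilbertFunction I (1 + m) ≤
      1 + m + finrank k (L • gradedPiece I m : Submodule k (MvPolynomial (Fin r) k ⧸ I))) :
    hilbertFunction I (1 + n) +
        finrank k (L • gradedPiece I m : Submodule k (MvPolynomial (Fin r) k ⧸ I)) ≤
      hilbertFunction I (1 + m) +
        finrank k (L • gradedPiece I n : Submodule k (MvPolynomial (Fin r) k ⧸ I)) := by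
  rw [← gradedPiece_inf_span_singleton hI hL, hilbertFunction, gradedPiece_eq_pow] at h
  rw [← gradedPiece_inf_span_singleton hI hL, ← gradedPiece_inf_span_singleton hI hL,
    hilbertFunction, hilbertFunction, gradedPiece_eq_pow I (1 + m), gradedPiece_eq_pow I (1 + n)]
  exact finrank_pow_add_finrank_inf_le _ (Nat.add_le_add_left hmn 1) h

end GradedPiece

section Duality

variable {k : Type*} [Field k] {r : ℕ} {I : Ideal (MvPolynomial (Fin r) k)} {e : ℕ}

theorem algebraSocle_eq_gradedPiece (h1 : finrank k (algebraSocle I) = 1)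
    (he : hilbertFunction I e ≠ 0) (htop : hilbertFunction I (e + 1) = 0) :
    algebraSocle I = gradedPiece I e := by
  have : Module.Finite k (algebraSocle I) := Module.finite_of_finrank_eq_succ h1
  have hle : gradedPiece I e ≤ algebraSocle I := fun a ha j => by
    have h := mul_mem_gradedPiece (mk_X_mem_gradedPiece j) ha
    rwa [add_comm, Submodule.finrank_eq_zero.1 htop, Submodule.mem_bot] at h
  refine (Submodule.eq_of_le_of_finrank_le hle ?_).symm
  rw [h1]
  exact Nat.one_le_iff_ne_zero.2 he

theorem exists_mul_ne_zero_of_mem_gradedPiece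
    (hI : I.IsHomogeneous (MvPolynomial.homogeneousSubmodule (Fin r) k))
    (hsoc : algebraSocle I ≤ gradedPiece I e)
    {m n : ℕ} (hmn : m + n = e) {a : MvPolynomial (Fin r) k ⧸ I} (ha : a ∈ gradedPiece I m)
    (ha0 : a ≠ 0) :
    ∃ b ∈ gradedPiece I n, a * b ≠ 0 := by
  induction n generalizing m a with
  | zero => exact ⟨1, one_mem_gradedPiece, by rwa [mul_one]⟩
  | succ n ih =>
    obtain ⟨j, hj⟩ : ∃ j, Ideal.Quotient.mk I (MvPolynomial.X j) * a ≠ 0 := by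
      by_contra! h
      exact ha0 (eq_zero_of_mem_gradedPiece_of_ne hI (by omega) ha (hsoc h))
    rw [mul_comm] at hj
    obtain ⟨b, hb, hb0⟩ := ih (by omega) (mul_mem_gradedPiece ha (mk_X_mem_gradedPiece j)) hj
    rw [mul_assoc] at hb0
    exact ⟨_, add_comm n 1 ▸ mul_mem_gradedPiece (mk_X_mem_gradedPiece j) hb, hb0⟩

theorem finrank_smul_gradedPiece
    (hI : I.IsHomogeneous (MvPolynomial.homogeneousSubmodule (Fin r) k))
    (hsoc : algebraSocle I = gradedPiece I e)
    (h1 : finrank k (algebraSocle I) = 1) {d m n : ℕ} (hdmn : d + m + n = e)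
    {b : MvPolynomial (Fin r) k ⧸ I} (hb : b ∈ gradedPiece I d) :
    finrank k (b • gradedPiece I m : Submodule k (MvPolynomial (Fin r) k ⧸ I)) =
      finrank k (b • gradedPiece I n : Submodule k (MvPolynomial (Fin r) k ⧸ I)) := by
  obtain ⟨φ, hφ⟩ := exists_dual_disjoint_ker_of_finrank_eq_one h1
  let B (m n : ℕ) : gradedPiece I m →ₗ[k] gradedPiece I n →ₗ[k] k :=
    ((LinearMap.mul k (MvPolynomial (Fin r) k ⧸ I)).compr₂ φ ∘ₗ
      LinearMap.mulLeft k b).domRestrict₁₂ (gradedPiece I m) (gradedPiece I n)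
  have hflip : (B m n).flip = B n m := by
    ext u w
    exact congrArg φ (mul_right_comm b w u)
  have hker (m n : ℕ) (hmn : d + m + n = e) : LinearMap.ker (B m n) =
      LinearMap.ker ((LinearMap.mulLeft k b).domRestrict (gradedPiece I m)) := by
    ext u
    refine ⟨fun hu => ?_, fun hu => ?_⟩
    · by_contra hbu
      have hmem := mul_mem_gradedPiece hb u.2
      obtain ⟨w, hw, hbuw⟩ := exists_mul_ne_zero_of_mem_gradedPiece hI hsoc.le hmn hmem hbu
      refine hbuw (Submodule.disjoint_def.1 hφ _ ?_ (LinearMap.congr_fun hu ⟨w, hw⟩))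
      rw [hsoc, ← hmn]
      exact mul_mem_gradedPiece hmem hw
    · ext w
      change φ (b * u * w) = 0
      rw [show b * u = 0 from hu, zero_mul, map_zero]
  have hrange (m n : ℕ) (hmn : d + m + n = e) : finrank k (LinearMap.range (B m n)) =
      finrank k (b • gradedPiece I m : Submodule k (MvPolynomial (Fin r) k ⧸ I)) := by
    rw [finrank_range_eq_of_ker_eq (hker m n hmn), LinearMap.range_domRestrict]
    rfl
  rw [← hrange m n hdmn, ← hrange n m (by omega), ← hflip, finrank_range_flip]

theorem hilbertFunction_eq_of_add_eq
    (hI : I.IsHomogeneous (MvPolynomial.homogeneousSubmodule (Fin r) k))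
    (hsoc : algebraSocle I = gradedPiece I e)
    (h1 : finrank k (algebraSocle I) = 1) {m n : ℕ} (hmn : m + n = e) :
    hilbertFunction I m = hilbertFunction I n := by
  have h := finrank_smul_gradedPiece hI hsoc h1 ((zero_add m).symm ▸ hmn) one_mem_gradedPiece
  rwa [one_smul, one_smul] at h

end Duality

theorem sum_min_le_hilbertFunction_of_lt {k : Type*} [Field k] [Infinite k] {r : ℕ}
    {I : Ideal (MvPolynomial (Fin r) k)}
    (hI : I.IsHomogeneous (MvPolynomial.homogeneousSubmodule (Fin r) k)) {e i j : ℕ}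
    (hsoc : algebraSocle I = gradedPiece I e) (h1 : finrank k (algebraSocle I) = 1)
    (hij : i ≤ j) (he : 1 + i + j = e) (hlt : hilbertFunction I (i + 1) < hilbertFunction I i) :
    ∑ t ∈ Finset.range (j + 2), min (i + 3) (t + 1) ≤ hilbertFunction I i := by
  have hsymm : hilbertFunction I (j + 1) = hilbertFunction I i :=
    hilbertFunction_eq_of_add_eq hI hsoc h1 (by omega)
  have hgreen : ∀ L ∈ gradedPiece I 1, i + 3 +
      finrank k (L • gradedPiece I j : Submodule k (MvPolynomial (Fin r) k ⧸ I)) ≤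
        hilbertFunction I (j + 1) := fun L hL => by
    have hrank := finrank_smul_gradedPiece hI hsoc h1 he hL
    by_contra! hsmall
    have hmac := hilbertFunction_add_finrank_smul_le hI hL hij (by
      rw [add_comm 1 i]
      omega)
    rw [add_comm 1 i, add_comm 1 j] at hmac
    omega
  rw [← hsymm]
  exact sum_min_le_hilbertFunction hgreen

theorem sum_range_min_add_choose_two (c m : ℕ) :
    ∑ t ∈ Finset.range (c + m), min c (t + 1) + (m + 1).choose 2 = (c + m + 1).choose 2 := by
  induction m with
  | zero =>
    have hmin : ∀ t ∈ Finset.range c, min c (t + 1) = t + 1 := fun t ht =>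
      min_eq_right (Finset.mem_range.1 ht)
    rw [add_zero, Finset.sum_congr rfl hmin, Nat.choose_two_right (c + 0 + 1),
      ← Finset.sum_range_id, Finset.sum_range_succ']
    rfl
  | succ m ih =>
    rw [← add_assoc, Finset.sum_range_succ, min_eq_left (by omega), Nat.choose_succ_succ' (m + 1),
      Nat.choose_succ_succ' (c + m + 1), ← ih, Nat.choose_one_right, Nat.choose_one_right]
    ring

theorem proposition2p5 (k : Type*) [Field k] [Infinite k] (e : ℕ) (h : ℕ → ℕ)
    (hh : IsGorensteinHVector k e h) (i : ℕ) (hi : (i : ℚ) ≤ (e : ℚ) / 2 - 1) :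
    ((e - i + 2).choose 2 : ℚ) - ((e - 2 * i - 1).choose 2 : ℚ)
        = ((i : ℚ) + 3) * (2 * (e : ℚ) - 3 * (i : ℚ)) / 2 ∧
      ((h i : ℚ) < ((e - i + 2).choose 2 : ℚ) - ((e - 2 * i - 1).choose 2 : ℚ) →
        h i ≤ h (i + 1)) := by
  obtain ⟨m, rfl⟩ : ∃ m, e = 2 * i + 2 + m := by
    refine Nat.exists_eq_add_of_le ?_
    exact_mod_cast (by linarith : (2 * i + 2 : ℚ) ≤ e)
  rw [show 2 * i + 2 + m - i + 2 = i + 3 + m + 1 by omega,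
    show 2 * i + 2 + m - 2 * i - 1 = m + 1 by omega]
  refine ⟨?_, fun hlt => ?_⟩
  · rw [Nat.cast_choose_two, Nat.cast_choose_two]
    push_cast
    ring
  · obtain ⟨r, I, hI, hH, he, htop⟩ := hh
    have hsoc := algebraSocle_eq_gradedPiece hI.finrank_socle (hH _ ▸ he)
      (hH _ ▸ htop _ (Nat.lt_succ_self _))
    by_contra! hdec
    rw [hH, hH] at hdec
    have hle := sum_min_le_hilbertFunction_of_lt hI.homogeneous hsoc hI.finrank_socle
      (j := i + 1 + m) (by omega) (by omega) hdec
    rw [← hH, show i + 1 + m + 2 = i + 3 + m by omega] at hle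
    rw [← sum_range_min_add_choose_two, Nat.cast_add, add_sub_cancel_right] at hlt
    exact hlt.not_ge (Nat.cast_le.2 hle)
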